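/- Let $K$ be a field, let $n\ge 1$ be an integer, and let $D$ be the lattice of the divisors of $2\cdot 3^{\,n-1}$, ordered by divisibility (meet is $\gcd$, join is $\mathrm{lcm}$). For $1\le i\le n$ write $x_i$ for the element $3^{\,i-1}$ and $y_i$ for the element $2\cdot 3^{\,i-1}$ of $D$, so that $D=\{x_1,\dots,x_n,y_1,\dots,y_n\}$. Let $K[D]$ be the polynomial ring over $K$ whose variables are the elements of $D$, and let \[ I_D=\bigl(ab-(a\wedge b)(a\vee b) : a,b\in D \text{ incomparable}\bigr)\subset K[D] \] be the join-meet ideal of $D$. Then, for every integer $k$ with $1\le k\le n-1$, the ideal $(I_D,\,x_{k+1}-y_k)$ of $K[D]$ is prime. -/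

import Mathlib

/-- The join-meet ideal of a lattice `L` over `K`: the ideal of the polynomial ring `K[L]`, whose
variables are the elements of `L`, generated by the binomials `ab - (a ∧ b)(a ∨ b)` with `a`, `b`
incomparable. -/
noncomputable def joinMeetIdeal (K : Type*) [CommRing K] (L : Type*) [Lattice L] : Ideal (MvPolynomial L K) :=
  Ideal.span {f | ∃ a b : L, ¬ a ≤ b ∧ ¬ b ≤ a ∧
    f = MvPolynomial.X a * MvPolynomial.X b - MvPolynomial.X (a ⊓ b) * MvPolynomial.X (a ⊔ b)}

/-- The divisors of `N`, to be ordered by divisibility (and not by size). -/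
@[ext]
structure DivisorLattice (N : ℕ) where
  val : ℕ
  dvd : val ∣ N

namespace DivisorLattice

/-- The lattice structure: the order is divisibility, meet is `gcd`, join is `lcm`. -/
instance instLattice (N : ℕ) : Lattice (DivisorLattice N) where
  le a b := a.val ∣ b.val
  le_refl a := dvd_refl a.val
  le_trans _ _ _ hab hbc := dvd_trans hab hbc
  le_antisymm _ _ hab hba := DivisorLattice.ext (Nat.dvd_antisymm hab hba)
  inf a b := ⟨Nat.gcd a.val b.val, (Nat.gcd_dvd_left _ _).trans a.dvd⟩
  inf_le_left a b := Nat.gcd_dvd_left a.val b.val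
  inf_le_right a b := Nat.gcd_dvd_right a.val b.val
  le_inf _ _ _ hab hac := Nat.dvd_gcd hab hac
  sup a b := ⟨Nat.lcm a.val b.val, Nat.lcm_dvd a.dvd b.dvd⟩
  le_sup_left a b := Nat.dvd_lcm_left a.val b.val
  le_sup_right a b := Nat.dvd_lcm_right a.val b.val
  sup_le _ _ _ hac hbc := Nat.lcm_dvd hac hbc

/-- The element `x_i = 3 ^ (i - 1)`, `1 ≤ i ≤ n`, of the lattice of divisors of `2 * 3 ^ (n - 1)`:
the chain `x_1 < ⋯ < x_n`, with `x_1` the least element of the lattice. -/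
def x (n i : ℕ) (hi : 1 ≤ i ∧ i ≤ n) : DivisorLattice (2 * 3 ^ (n - 1)) :=
  ⟨3 ^ (i - 1), (pow_dvd_pow 3 (by omega)).mul_left 2⟩

/-- The element `y_i = 2 * 3 ^ (i - 1)`, `1 ≤ i ≤ n`, of the lattice of divisors of
`2 * 3 ^ (n - 1)`: the chain `y_1 < ⋯ < y_n`, with `y_n` the greatest element of the lattice;
`y_i` covers `x_i`. -/
def y (n i : ℕ) (hi : 1 ≤ i ∧ i ≤ n) : DivisorLattice (2 * 3 ^ (n - 1)) :=
  ⟨2 * 3 ^ (i - 1), mul_dvd_mul_left 2 (pow_dvd_pow 3 (by omega))⟩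

end DivisorLattice

/-!
The ideal `(I_D, x_{k+1} - y_k)` is the ideal of `2`-minors of the matrix with columns `(x_i, y_i)`
in which `y_k` and `x_{k+1}` are identified, and it is the toric ideal of a rational normal scroll. The variables fall into blocks: the columns `k` and `k + 1` together form one block, with
the levels `x_k`, `y_k = x_{k+1}`, `y_{k+1}`, and every other column `i` is a block with the levels
`x_i`, `y_i`. Sending a variable of block `c` and level `l` to the monomial `T_c U ^ l` defines a
homomorphism to a polynomial ring, `scrollHom`, whose kernel is prime and contains the ideal.

For the converse inclusion it is enough that two monomials with the same image are congruent modulo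
the ideal (`MvPolynomial.ker_aeval_monomial_le`). Such monomials have the same multiset of blocks
and the same total level. The minors allow raising the level of one factor by one while lowering
that of another by one, and finitely many such moves lead from one monomial to the other
(`prod_eq_prod_of_moves`).
-/

/-! ### Products connected by level moves -/

/-- Suppose that the value `q v` of a variable depends only on its block `b v` and its level `l v`,
and that in a product of two values one level can be raised and the other lowered by one, as long
as the two blocks have room for it. Then a product of values depends only on the blocks of its
factors and on the sum of their levels. -/
theorem prod_eq_prod_of_moves {ι σ β R : Type*} [Fintype ι] [CommMonoid R]
    (b : σ → β) (l : σ → ℕ) (q : σ → R)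
    (hq : ∀ v w, b v = b w → l v = l w → q v = q w)
    (hmove : ∀ v v' w w', b v = b v' → l v < l v' → b w = b w' → l w' < l w →
      ∃ v₁ w₁, b v₁ = b v ∧ l v₁ = l v + 1 ∧ b w₁ = b w ∧ l w₁ + 1 = l w ∧
        q v * q w = q v₁ * q w₁)
    (f g : ι → σ) (hb : ∀ i, b (f i) = b (g i)) (hl : ∑ i, l (f i) = ∑ i, l (g i)) :
    ∏ i, q (f i) = ∏ i, q (g i) := by
  classical
  -- The truncated differences measure by how much `f` exceeds `g`.
  induction hN : ∑ i, (l (f i) - l (g i)) using Nat.strong_induction_on generalizing f with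
  | _ N ih =>
  by_cases hle : ∀ i, l (f i) ≤ l (g i)
  · have heq := (Finset.sum_eq_sum_iff_of_le (fun i _ => hle i)).1 hl
    exact Finset.prod_congr rfl fun i hi => hq _ _ (hb i) (heq i hi)
  · push Not at hle
    obtain ⟨i, hi⟩ := hle
    obtain ⟨j, hj⟩ : ∃ j, l (f j) < l (g j) := by
      by_contra! h
      have := Finset.sum_lt_sum (fun j _ => h j) ⟨i, Finset.mem_univ i, hi⟩
      omega
    have hij : i ≠ j := by rintro rfl; omega
    obtain ⟨v, w, hv, hlv, hw, hlw, hvw⟩ :=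
      hmove (f j) (g j) (f i) (g i) (hb j) hj (hb i) hi
    set f' : ι → σ := Function.update (Function.update f j v) i w with hf'
    have hfi : f' i = w := by simp [hf']
    have hfj : f' j = v := by simp [hf', Function.update_of_ne hij.symm]
    have hfo : ∀ m, m ≠ i → m ≠ j → f' m = f m := fun m h1 h2 => by
      simp [hf', Function.update_of_ne h1, Function.update_of_ne h2]
    have hsplit (h : ι → ℕ) :
        ∑ m, h m = h i + (h j + ∑ m ∈ (Finset.univ.erase i).erase j, h m) := by
      rw [Finset.add_sum_erase _ _ (by simp [hij.symm]), Finset.add_sum_erase _ _ (by simp)]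
    have hsplit' (h : ι → R) :
        ∏ m, h m = h i * (h j * ∏ m ∈ (Finset.univ.erase i).erase j, h m) := by
      rw [Finset.mul_prod_erase _ _ (by simp [hij.symm]), Finset.mul_prod_erase _ _ (by simp)]
    have hrest : ∀ m ∈ (Finset.univ.erase i).erase j, f' m = f m := fun m hm => by
      simp only [Finset.mem_erase] at hm
      exact hfo m hm.2.1 hm.1
    have hprod : ∏ m, q (f m) = ∏ m, q (f' m) := by
      rw [hsplit' fun m => q (f m), hsplit' fun m => q (f' m), hfi, hfj,
        Finset.prod_congr rfl fun m hm => congrArg q (hrest m hm), ← mul_assoc, ← mul_assoc,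
        mul_comm (q (f i)), hvw, mul_comm (q w)]
    rw [hprod]
    refine ih (∑ m, (l (f' m) - l (g m))) ?_ f' ?_ ?_ rfl
    · rw [← hN]
      refine Finset.sum_lt_sum (fun m _ => ?_) ⟨i, Finset.mem_univ i, by rw [hfi]; omega⟩
      rcases eq_or_ne m i with rfl | h1
      · rw [hfi]; omega
      rcases eq_or_ne m j with rfl | h2
      · rw [hfj]; omega
      rw [hfo m h1 h2]
    · intro m
      rcases eq_or_ne m i with rfl | h1
      · rw [hfi, hw, hb]
      rcases eq_or_ne m j with rfl | h2
      · rw [hfj, hv, hb]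
      rw [hfo m h1 h2, hb]
    · rw [← hl, hsplit fun m => l (f m), hsplit fun m => l (f' m), hfi, hfj,
        Finset.sum_congr rfl fun m hm => congrArg l (hrest m hm)]
      omega

theorem Multiset.Rel.exists_zip {α β : Type*} {r : α → β → Prop} {s : Multiset α}
    {t : Multiset β} (h : Multiset.Rel r s t) :
    ∃ M : Multiset (α × β), M.map Prod.fst = s ∧ M.map Prod.snd = t ∧ ∀ p ∈ M, r p.1 p.2 := by
  induction h with
  | zero => exact ⟨0, by simp⟩
  | @cons a b s t hab _ ih =>
    obtain ⟨M, rfl, rfl, hM⟩ := ih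
    exact ⟨(a, b) ::ₘ M, by simp, by simp, by simpa using ⟨hab, fun a b => hM (a, b)⟩⟩

/-- The form of `prod_eq_prod_of_moves` for multisets, whose factors need not come paired by
blocks. -/
theorem Multiset.prod_map_eq_of_moves {σ β R : Type*} [CommMonoid R]
    (b : σ → β) (l : σ → ℕ) (q : σ → R)
    (hq : ∀ v w, b v = b w → l v = l w → q v = q w)
    (hmove : ∀ v v' w w', b v = b v' → l v < l v' → b w = b w' → l w' < l w →
      ∃ v₁ w₁, b v₁ = b v ∧ l v₁ = l v + 1 ∧ b w₁ = b w ∧ l w₁ + 1 = l w ∧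
        q v * q w = q v₁ * q w₁)
    {s t : Multiset σ} (hb : s.map b = t.map b) (hl : (s.map l).sum = (t.map l).sum) :
    (s.map q).prod = (t.map q).prod := by
  rw [← Multiset.rel_eq, Multiset.rel_map] at hb
  obtain ⟨M, rfl, rfl, hM⟩ := hb.exists_zip
  obtain ⟨L, rfl⟩ := Quotient.exists_rep M
  have hL (h : σ × σ → R) : (L.map h).prod = ∏ i : Fin L.length, h L[i] := by
    rw [← List.prod_ofFn]
    congr 1
    apply List.ext_getElem <;> simp
  have hL' (h : σ × σ → ℕ) : (L.map h).sum = ∑ i : Fin L.length, h L[i] := by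
    rw [← List.sum_ofFn]
    congr 1
    apply List.ext_getElem <;> simp
  simp only [Multiset.quot_mk_to_coe, Multiset.map_coe, Multiset.sum_coe, Multiset.prod_coe,
    List.map_map, hL, hL', Multiset.mem_coe] at hl hM ⊢
  exact prod_eq_prod_of_moves b l q hq hmove (fun i : Fin L.length => L[i].1) (fun i => L[i].2)
    (fun i => hM _ (List.getElem_mem _)) hl

/-! ### Kernels of monomial maps -/

namespace MvPolynomial

theorem map_monomial_one_eq_prod {K σ S : Type*} [CommSemiring K] [CommSemiring S]
    (f : MvPolynomial σ K →+* S) (m : σ →₀ ℕ) :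
    f (monomial m 1) = (m.toMultiset.map fun v => f (X v)).prod := by
  induction m using Finsupp.induction_linear with
  | zero => simp
  | add a b ha hb =>
    rw [← mul_one (1 : K), ← monomial_mul, map_mul, ha, hb, Finsupp.toMultiset_add,
      Multiset.map_add, Multiset.prod_add]
  | single v e =>
    rw [← X_pow_eq_monomial, map_pow, Finsupp.toMultiset_single, Multiset.map_nsmul,
      Multiset.prod_nsmul, Multiset.map_singleton, Multiset.prod_singleton]

theorem prod_map_monomial_one {K σ τ : Type*} [CommSemiring K] (A : σ → τ →₀ ℕ)
    (s : Multiset σ) :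
    (s.map fun v => monomial (A v) (1 : K)).prod = monomial (s.map A).sum 1 := by
  induction s using Multiset.induction_on with
  | empty => simp
  | cons v s ih => simp [ih, monomial_mul]

/-- The kernel of a homomorphism that sends variables to monomials is spanned by differences of
monomials: it lies in every ideal modulo which monomials with the same image are congruent. -/
theorem ker_aeval_monomial_le {K σ τ : Type*} [CommRing K] (A : σ → τ →₀ ℕ)
    (I : Ideal (MvPolynomial σ K))
    (h : ∀ s t : Multiset σ, (s.map A).sum = (t.map A).sum →
      (s.map fun v => Ideal.Quotient.mk I (X v)).prod =
        (t.map fun v => Ideal.Quotient.mk I (X v)).prod) :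
    RingHom.ker (aeval fun v => monomial (A v) (1 : K)) ≤ I := by
  classical
  have hmon (m : σ →₀ ℕ) : Ideal.Quotient.mk I (monomial m 1) =
      (m.toMultiset.map fun v => Ideal.Quotient.mk I (X v)).prod :=
    map_monomial_one_eq_prod _ m
  have haeval (m : σ →₀ ℕ) : aeval (fun v => monomial (A v) (1 : K)) (monomial m (1 : K)) =
      monomial (m.toMultiset.map A).sum 1 := by
    rw [← prod_map_monomial_one]
    refine (map_monomial_one_eq_prod (aeval fun v => monomial (A v) (1 : K)).toRingHom m).trans ?_
    simp
  -- A linear map sending each monomial in the image to the class of a chosen preimage.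
  let r : (τ →₀ ℕ) → (σ →₀ ℕ) := Function.invFun fun m => (m.toMultiset.map A).sum
  let ψ : MvPolynomial τ K →ₗ[K] (MvPolynomial σ K ⧸ I) :=
    (basisMonomials τ K).constr K fun a => Ideal.Quotient.mk I (monomial (r a) 1)
  have hψ : ψ ∘ₗ (aeval fun v => monomial (A v) (1 : K)).toLinearMap =
      (Ideal.Quotient.mkₐ K I).toLinearMap := by
    refine (basisMonomials σ K).ext fun m => ?_
    have hb : monomial (m.toMultiset.map A).sum (1 : K) =
      basisMonomials τ K (m.toMultiset.map A).sum := by simp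
    simp only [coe_basisMonomials, LinearMap.comp_apply, AlgHom.toLinearMap_apply, haeval,
      Ideal.Quotient.mkₐ_eq_mk]
    rw [hb, Module.Basis.constr_basis, hmon, hmon]
    exact h _ _ (Function.invFun_eq (f := fun m : σ →₀ ℕ => (m.toMultiset.map A).sum) ⟨m, rfl⟩)
  intro f hf
  have := LinearMap.congr_fun hψ f
  rw [LinearMap.comp_apply, AlgHom.toLinearMap_apply, RingHom.mem_ker.1 hf, map_zero] at this
  exact Ideal.Quotient.eq_zero_iff_mem.1 this.symm

end MvPolynomial

/-! ### The lattice of divisors of `2 * 3 ^ (n - 1)` -/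

namespace DivisorLattice

open MvPolynomial

theorem eq_x_or_eq_y {n : ℕ} (hn : 1 ≤ n) (d : DivisorLattice (2 * 3 ^ (n - 1))) :
    ∃ i hi, d = x n i hi ∨ d = y n i hi := by
  obtain ⟨a, c, ha, hc, hd⟩ := (Nat.dvd_mul).1 d.dvd
  obtain ⟨j, hj, rfl⟩ := (Nat.dvd_prime_pow Nat.prime_three).1 hc
  refine ⟨j + 1, ⟨by omega, by omega⟩, ?_⟩
  rcases (Nat.dvd_prime Nat.prime_two).1 ha with rfl | rfl
  · exact Or.inl (DivisorLattice.ext (by simpa [x] using hd.symm))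
  · exact Or.inr (DivisorLattice.ext (by simpa [y] using hd.symm))

/-- The block of a divisor `x_i` or `y_i`: its column `i`, except that column `k + 1` belongs to
the block `k`. The column of a divisor is one more than its exponent of `3`. -/
def block (k : ℕ) {N : ℕ} (d : DivisorLattice N) : ℕ :=
  if d.val.factorization 3 = k then k else d.val.factorization 3 + 1

/-- The level of a divisor in its block: `0` for `x_i` and `1` for `y_i`, raised by one in the
column `k + 1`. -/
def level (k : ℕ) {N : ℕ} (d : DivisorLattice N) : ℕ :=
  d.val.factorization 2 + if d.val.factorization 3 = k then 1 else 0

section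

variable {n : ℕ} (k : ℕ) {i : ℕ} (hi : 1 ≤ i ∧ i ≤ n)

theorem factorization_three_x : (x n i hi).val.factorization 3 = i - 1 := by
  simp [x, Nat.prime_three.factorization]

theorem factorization_two_x : (x n i hi).val.factorization 2 = 0 := by
  simp [x, Nat.prime_three.factorization]

theorem factorization_three_y : (y n i hi).val.factorization 3 = i - 1 := by
  simp [y, Nat.factorization_mul, Nat.prime_three.factorization, Nat.prime_two.factorization]

theorem factorization_two_y : (y n i hi).val.factorization 2 = 1 := by
  simp [y, Nat.factorization_mul, Nat.prime_three.factorization, Nat.prime_two.factorization]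

theorem block_x : block k (x n i hi) = if i = k + 1 then k else i := by
  rw [block, factorization_three_x]; split_ifs <;> omega

theorem block_y : block k (y n i hi) = if i = k + 1 then k else i := by
  rw [block, factorization_three_y]; split_ifs <;> omega

theorem level_x : level k (x n i hi) = if i = k + 1 then 1 else 0 := by
  rw [level, factorization_three_x, factorization_two_x]; split_ifs <;> omega

theorem level_y : level k (y n i hi) = 1 + if i = k + 1 then 1 else 0 := by
  rw [level, factorization_three_y, factorization_two_y]; split_ifs <;> omega

end

section

variable {n : ℕ} {i j : ℕ} (hi : 1 ≤ i ∧ i ≤ n) (hj : 1 ≤ j ∧ j ≤ n)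

theorem x_le_x (h : i ≤ j) : x n i hi ≤ x n j hj :=
  pow_dvd_pow 3 (by omega : i - 1 ≤ j - 1)

theorem y_le_y (h : i ≤ j) : y n i hi ≤ y n j hj :=
  mul_dvd_mul_left 2 (pow_dvd_pow 3 (by omega : i - 1 ≤ j - 1))

theorem x_le_y (h : i ≤ j) : x n i hi ≤ y n j hj :=
  (pow_dvd_pow 3 (by omega : i - 1 ≤ j - 1)).mul_left 2

theorem not_y_le_x : ¬ y n i hi ≤ x n j hj := fun h => by
  have h2 : 2 ∣ 3 ^ (j - 1) := (Dvd.intro _ rfl).trans h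
  have := Nat.prime_two.dvd_of_dvd_pow h2
  omega

theorem not_x_le_y (h : j < i) : ¬ x n i hi ≤ y n j hj := fun hle => by
  have h3 : 3 ^ (i - 1) ∣ 3 ^ (j - 1) :=
    (Nat.Coprime.pow_left _ (by norm_num : Nat.Coprime 3 2)).dvd_of_dvd_mul_left hle
  have := (Nat.pow_dvd_pow_iff_le_right (by norm_num)).1 h3
  omega

theorem x_inf_y (h : j ≤ i) : x n i hi ⊓ y n j hj = x n j hj := by
  refine le_antisymm ?_ (le_inf (x_le_x _ _ h) (x_le_y _ _ le_rfl))
  have h1 : Nat.Coprime (3 ^ (i - 1)) 2 := Nat.Coprime.pow_left _ (by norm_num)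
  change Nat.gcd (3 ^ (i - 1)) (2 * 3 ^ (j - 1)) ∣ 3 ^ (j - 1)
  rw [h1.symm.gcd_mul_left_cancel_right]
  exact Nat.gcd_dvd_right _ _

theorem x_sup_y (h : j ≤ i) : x n i hi ⊔ y n j hj = y n i hi := by
  refine le_antisymm (sup_le (x_le_y _ _ le_rfl) (y_le_y _ _ h)) ?_
  refine Nat.Coprime.mul_dvd_of_dvd_of_dvd (Nat.Coprime.pow_right _ (by norm_num)) ?_ ?_
  · exact (Dvd.intro _ rfl : 2 ∣ 2 * 3 ^ (j - 1)).trans (Nat.dvd_lcm_right _ _)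
  · exact Nat.dvd_lcm_left _ _

end

/-! ### The toric parametrization -/

/-- The exponent of the monomial `T_c U ^ l` attached to a divisor of block `c` and level `l`;
the index `some c` stands for `T_c` and the index `none` for `U`. -/
noncomputable def scrollExponent (k : ℕ) {N : ℕ} (d : DivisorLattice N) : Option ℕ →₀ ℕ :=
  Finsupp.single (some (block k d)) 1 + Finsupp.single none (level k d)

/-- The parametrization of the scroll, sending a divisor of block `c` and level `l` to
`T_c U ^ l`. -/
noncomputable def scrollHom (K : Type*) [CommRing K] (k N : ℕ) :
    MvPolynomial (DivisorLattice N) K →ₐ[K] MvPolynomial (Option ℕ) K :=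
  aeval fun d => monomial (scrollExponent k d) 1

theorem sum_map_scrollExponent_none (k : ℕ) {N : ℕ} (s : Multiset (DivisorLattice N)) :
    (s.map (scrollExponent k)).sum none = (s.map (level k)).sum := by
  induction s using Multiset.induction_on with
  | empty => simp
  | cons d s ih => simp [ih, scrollExponent]

theorem sum_map_scrollExponent_some (k : ℕ) {N : ℕ} (s : Multiset (DivisorLattice N)) (c : ℕ) :
    (s.map (scrollExponent k)).sum (some c) = (s.map (block k)).count c := by
  induction s using Multiset.induction_on with
  | empty => simp
  | cons d s ih =>
    simp [ih, scrollExponent, Multiset.count_cons, Finsupp.single_apply, add_comm, eq_comm]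

/-- Hence the generators of the join-meet ideal are the minors `x_i y_j - x_j y_i`, `j < i`. -/
theorem exists_x_y_of_incomparable {n : ℕ} (hn : 1 ≤ n)
    {a b : DivisorLattice (2 * 3 ^ (n - 1))} (hab : ¬ a ≤ b) (hba : ¬ b ≤ a) :
    ∃ i j hi hj, j < i ∧
      (a = x n i hi ∧ b = y n j hj ∨ a = y n j hj ∧ b = x n i hi) := by
  obtain ⟨i, hi, rfl | rfl⟩ := eq_x_or_eq_y hn a <;>
    obtain ⟨j, hj, rfl | rfl⟩ := eq_x_or_eq_y hn b
  · rcases le_total i j with h | h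
    exacts [absurd (x_le_x _ _ h) hab, absurd (x_le_x _ _ h) hba]
  · exact ⟨i, j, hi, hj, not_le.1 fun h => hab (x_le_y _ _ h), Or.inl ⟨rfl, rfl⟩⟩
  · exact ⟨j, i, hj, hi, not_le.1 fun h => hba (x_le_y _ _ h), Or.inr ⟨rfl, rfl⟩⟩
  · rcases le_total i j with h | h
    exacts [absurd (y_le_y _ _ h) hab, absurd (y_le_y _ _ h) hba]

theorem le_ker_scrollHom (K : Type*) [CommRing K] {n k : ℕ} (hk : 1 ≤ k ∧ k ≤ n)
    (hk' : 1 ≤ k + 1 ∧ k + 1 ≤ n) :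
    joinMeetIdeal K (DivisorLattice (2 * 3 ^ (n - 1))) ⊔
      Ideal.span {X (x n (k + 1) hk') - X (y n k hk)} ≤
        RingHom.ker (scrollHom K k (2 * 3 ^ (n - 1))) := by
  have hminor {i j : ℕ} (hi : 1 ≤ i ∧ i ≤ n) (hj : 1 ≤ j ∧ j ≤ n) :
      scrollExponent k (x n i hi) + scrollExponent k (y n j hj) =
        scrollExponent k (x n j hj) + scrollExponent k (y n i hi) := by
    simp only [scrollExponent, block_x, block_y, level_x, level_y, Finsupp.single_add]
    abel
  refine sup_le (Ideal.span_le.2 ?_) (Ideal.span_le.2 ?_)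
  · rintro _ ⟨a, b, hab, hba, rfl⟩
    rw [SetLike.mem_coe, RingHom.mem_ker]
    obtain ⟨i, j, hi, hj, hij, ⟨rfl, rfl⟩ | ⟨rfl, rfl⟩⟩ :=
      exists_x_y_of_incomparable (by omega) hab hba
    · simp [scrollHom, x_inf_y _ _ hij.le, x_sup_y _ _ hij.le, monomial_mul, hminor hi hj]
    · rw [inf_comm, sup_comm, mul_comm (X (y n j hj))]
      simp [scrollHom, x_inf_y _ _ hij.le, x_sup_y _ _ hij.le, monomial_mul, hminor hi hj]
  · rintro _ rfl
    simp [RingHom.mem_ker, scrollHom, scrollExponent, block_x, block_y, level_x, level_y]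

/-- All the minors of the matrix with columns `(x_i, y_i)` vanish modulo the join-meet ideal. -/
theorem mk_x_mul_mk_y {K : Type*} [CommRing K] {n : ℕ}
    {I : Ideal (MvPolynomial (DivisorLattice (2 * 3 ^ (n - 1))) K)}
    (hI : joinMeetIdeal K (DivisorLattice (2 * 3 ^ (n - 1))) ≤ I)
    {i j : ℕ} (hi : 1 ≤ i ∧ i ≤ n) (hj : 1 ≤ j ∧ j ≤ n) :
    Ideal.Quotient.mk I (X (x n i hi)) * Ideal.Quotient.mk I (X (y n j hj)) =
      Ideal.Quotient.mk I (X (x n j hj)) * Ideal.Quotient.mk I (X (y n i hi)) := by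
  wlog h : j ≤ i generalizing i j
  · exact (this hj hi (by omega)).symm
  rcases h.eq_or_lt with rfl | h
  · rfl
  rw [← map_mul, ← map_mul, Ideal.Quotient.eq]
  refine hI (Ideal.subset_span ⟨_, _, not_x_le_y hi hj h, not_y_le_x hj hi, ?_⟩)
  rw [x_inf_y _ _ h.le, x_sup_y _ _ h.le]

theorem ker_scrollHom (K : Type*) [CommRing K] {n k : ℕ} (hk : 1 ≤ k ∧ k ≤ n)
    (hk' : 1 ≤ k + 1 ∧ k + 1 ≤ n) :
    RingHom.ker (scrollHom K k (2 * 3 ^ (n - 1))) =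
      joinMeetIdeal K (DivisorLattice (2 * 3 ^ (n - 1))) ⊔
        Ideal.span {X (x n (k + 1) hk') - X (y n k hk)} := by
  refine le_antisymm ?_ (le_ker_scrollHom K hk hk')
  set I := joinMeetIdeal K (DivisorLattice (2 * 3 ^ (n - 1))) ⊔
    Ideal.span {X (x n (k + 1) hk') - X (y n k hk)}
  have hxy : Ideal.Quotient.mk I (X (x n (k + 1) hk')) =
      Ideal.Quotient.mk I (X (y n k hk)) :=
    Ideal.Quotient.eq.2 (Ideal.mem_sup_right (Ideal.subset_span rfl))
  have hq (v w : DivisorLattice (2 * 3 ^ (n - 1))) (hb : block k v = block k w)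
      (hl : level k v = level k w) :
      Ideal.Quotient.mk I (X v) = Ideal.Quotient.mk I (X w) := by
    obtain ⟨i, hi, rfl | rfl⟩ := eq_x_or_eq_y (by omega) v <;>
      obtain ⟨j, hj, rfl | rfl⟩ := eq_x_or_eq_y (by omega) w <;>
      simp only [block_x, block_y, level_x, level_y] at hb hl
    · obtain rfl : i = j := by split_ifs at hb hl <;> omega
      rfl
    · obtain ⟨rfl, rfl⟩ : i = k + 1 ∧ j = k := by split_ifs at hb hl <;> omega
      exact hxy
    · obtain ⟨rfl, rfl⟩ : j = k + 1 ∧ i = k := by split_ifs at hb hl <;> omega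
      exact hxy.symm
    · obtain rfl : i = j := by split_ifs at hb hl <;> omega
      rfl
  -- A divisor that is not on the top level of its block may be taken to be some `x_i`, and one
  -- that is not on the bottom level to be some `y_j`.
  have hx (v v' : DivisorLattice (2 * 3 ^ (n - 1))) (hb : block k v = block k v')
      (hl : level k v < level k v') :
      ∃ i hi, block k v = block k (x n i hi) ∧ level k v = level k (x n i hi) := by
    obtain ⟨i, hi, rfl | rfl⟩ := eq_x_or_eq_y (by omega) v
    · exact ⟨i, hi, rfl, rfl⟩
    · refine ⟨k + 1, hk', ?_⟩
      obtain ⟨j, hj, rfl | rfl⟩ := eq_x_or_eq_y (by omega) v' <;>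
        simp only [block_x, block_y, level_x, level_y] at hb hl ⊢ <;>
        split_ifs at hb hl ⊢ <;> omega
  have hy (v v' : DivisorLattice (2 * 3 ^ (n - 1))) (hb : block k v = block k v')
      (hl : level k v' < level k v) :
      ∃ i hi, block k v = block k (y n i hi) ∧ level k v = level k (y n i hi) := by
    obtain ⟨i, hi, rfl | rfl⟩ := eq_x_or_eq_y (by omega) v
    · refine ⟨k, hk, ?_⟩
      obtain ⟨j, hj, rfl | rfl⟩ := eq_x_or_eq_y (by omega) v' <;>
        simp only [block_x, block_y, level_x, level_y] at hb hl ⊢ <;>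
        split_ifs at hb hl ⊢ <;> omega
    · exact ⟨i, hi, rfl, rfl⟩
  refine MvPolynomial.ker_aeval_monomial_le _ I fun s t hst => ?_
  refine Multiset.prod_map_eq_of_moves (block k) (level k) _ hq ?_ ?_ ?_
  · intro v v' w w' hb hl hb' hl'
    obtain ⟨i, hi, hvb, hvl⟩ := hx v v' hb hl
    obtain ⟨j, hj, hwb, hwl⟩ := hy w w' hb' hl'
    refine ⟨y n i hi, x n j hj, ?_, ?_, ?_, ?_, ?_⟩
    · rw [hvb, block_x, block_y]
    · rw [hvl, level_x, level_y, add_comm]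
    · rw [hwb, block_x, block_y]
    · rw [hwl, level_x, level_y, add_comm]
    · rw [hq _ _ hvb hvl, hq _ _ hwb hwl, mk_x_mul_mk_y le_sup_left hi hj]
      exact mul_comm _ _
  · ext c
    rw [← sum_map_scrollExponent_some, ← sum_map_scrollExponent_some, hst]
  · rw [← sum_map_scrollExponent_none, ← sum_map_scrollExponent_none, hst]

end DivisorLattice

theorem lemma4p1 (K : Type*) [Field K] (n k : ℕ) (hk : 1 ≤ k) (hkn : k + 1 ≤ n) :
    (joinMeetIdeal K (DivisorLattice (2 * 3 ^ (n - 1))) ⊔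
      Ideal.span {MvPolynomial.X (DivisorLattice.x n (k + 1) ⟨by omega, hkn⟩) -
        MvPolynomial.X (DivisorLattice.y n k ⟨hk, by omega⟩)}).IsPrime := by
  rw [← DivisorLattice.ker_scrollHom K]
  exact RingHom.ker_isPrime _
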